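/- Let $R$ be an integral domain with quotient field $K$. An ideal $I$ of $R$ is invertible if $IJ=R$ for some $R$-submodule $J$ of $K$; $R$ is a Prüfer domain if every nonzero finitely generated ideal of $R$ is invertible. Let $\mathrm{Max}^{-1}(R)$ be the set of nonzero maximal ideals of $R$ (that is, all maximal ideals if $R$ is not a field, and the empty set if $R$ is a field) with the inverse topology, which has as a basis of open sets the sets $V(I)=\{M\in \mathrm{Max}^{-1}(R) : I\subseteq M\}$ with $I$ a finitely generated ideal of $R$; this is a Hausdorff space. For a Hausdorff space $X$, let $U(X)$ be the monoid, under pointwise addition, of the compactly supported upper semicontinuous functions $f:X\to\mathbb{N}_0$, ordered by $f\le_d g$ iff $f(x)\ge g(x)$ for all $x\in X$, and let $U_b(X)=U(X)\cup\{b\}$, where $b$ is an additional least element with $b+f=f+b=b$ for all $f\in U_b(X)$. Then the following are equivalent. 1. Each proper ideal of $R$ is a product of finitely many radical ideals. 2. Each nonzero ideal $I$ of $R$ can be written in exactly one way as a product $I=J_1\cdots J_n$ ($n\ge 0$, the empty product being $R$) of proper radical ideals with $J_1\subseteq\cdots\subseteq J_n$. 3. $\dim(R)\le 1$ and each invertible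 ideal of $R$ is a product of finitely many radical ideals of $R$. 4. Each nonzero prime ideal of $R$ is maximal and contains an invertible radical ideal. 5. The radical of each nonzero finitely generated ideal of $R$ is invertible. 6. The multiplicative lattice of ideals of $R$ is isomorphic to $U_b(\mathrm{Max}^{-1}(R))$, i.e. there is a bijection $\varphi$ from the set of ideals of $R$ to $U_b(\mathrm{Max}^{-1}(R))$ with $\varphi(IJ)=\varphi(I)+\varphi(J)$ and $I\subseteq J\iff\varphi(I)\le_d\varphi(J)$ for all ideals $I,J$ of $R$. 7. $R$ is a Prüfer domain and the radical of each finitely generated ideal of $R$ is finitely generated. -/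

import Mathlib

open scoped nonZeroDivisors

section IdealNotions

variable {R : Type*} [CommRing R]

/-- `I` is a finite product of radical ideals. -/
def Ideal.IsProdOfRadicals (I : Ideal R) : Prop :=
  ∃ l : List (Ideal R), (∀ J ∈ l, J.IsRadical) ∧ l.prod = I

/-- The list `J₁, …, Jₙ` (possibly empty) consists of proper radical ideals with
`J₁ ⊆ ⋯ ⊆ Jₙ` and `J₁ ⋯ Jₙ = I`. -/
def Ideal.IsProperRadicalChain (I : Ideal R) (l : List (Ideal R)) : Prop :=
  (∀ J ∈ l, J.IsRadical ∧ J ≠ ⊤) ∧ l.Pairwise (· ≤ ·) ∧ l.prod = I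

/-- `I` is invertible as a fractional ideal of the (total) quotient ring of `R`. -/
def Ideal.IsInvertibleIdeal (I : Ideal R) : Prop :=
  IsUnit (I : FractionalIdeal R⁰ (FractionRing R))

variable (R) in
/-- Prüfer domains: every nonzero finitely generated ideal is invertible. -/
def IsPruferDomain : Prop :=
  IsDomain R ∧ ∀ I : Ideal R, I ≠ ⊥ → I.FG → I.IsInvertibleIdeal

variable (R) in
/-- The set of nonzero (for a domain: regular) maximal ideals of `R`. This is the set of all
maximal ideals unless `R` is a field, in which case it is empty. -/
def MaxInv : Type _ := {M : Ideal R // M.IsMaximal ∧ M ≠ ⊥}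

/-- The basic open set `V(I)` of the maximal ideals in `MaxInv R` that contain `I`. -/
def MaxInv.V (I : Ideal R) : Set (MaxInv R) := {M | I ≤ M.1}

/-- The inverse topology, generated by the sets `V(I)` with `I` finitely generated; since
`V(I) ∩ V(J) = V(I + J)`, these sets form a basis. -/
instance MaxInv.instTopologicalSpace : TopologicalSpace (MaxInv R) :=
  TopologicalSpace.generateFrom {U | ∃ I : Ideal R, I.FG ∧ U = MaxInv.V I}

/-- The inverse topology is Hausdorff. -/
instance MaxInv.instT2Space : T2Space (MaxInv R) where
  t2 M N hMN := by
    have hne : M.1 ≠ N.1 := fun h => hMN (Subtype.ext h)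
    have hsup : M.1 ⊔ N.1 = ⊤ := M.2.1.coprime_of_ne N.2.1 hne
    obtain ⟨a, ha, b, hb, hab⟩ :=
      Submodule.mem_sup.1 ((Ideal.eq_top_iff_one _).1 hsup)
    refine ⟨MaxInv.V (Ideal.span {a}), MaxInv.V (Ideal.span {b}),
      TopologicalSpace.isOpen_generateFrom_of_mem ⟨_, ⟨{a}, by simp⟩, rfl⟩,
      TopologicalSpace.isOpen_generateFrom_of_mem ⟨_, ⟨{b}, by simp⟩, rfl⟩, ?_, ?_, ?_⟩
    · exact (Ideal.span_singleton_le_iff_mem _).2 ha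
    · exact (Ideal.span_singleton_le_iff_mem _).2 hb
    · refine Set.disjoint_left.2 fun P hPa hPb => P.2.1.ne_top ?_
      rw [Ideal.eq_top_iff_one, ← hab]
      exact add_mem ((Ideal.span_singleton_le_iff_mem _).1 hPa)
        ((Ideal.span_singleton_le_iff_mem _).1 hPb)

end IdealNotions

section UpperSemicontinuousFunctions

variable (X : Type*) [TopologicalSpace X] [T2Space X]

/-- `U(X)`: the monoid of compactly supported upper semicontinuous functions `X → ℕ` under
pointwise addition. -/
def UscFun : AddSubmonoid (X → ℕ) where
  carrier := {f | UpperSemicontinuous f ∧ HasCompactSupport f}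
  zero_mem' := ⟨upperSemicontinuous_const, HasCompactSupport.zero⟩
  add_mem' hf hg := ⟨hf.1.add hg.1, hf.2.add hg.2⟩

/-- `U_b(X)`, written multiplicatively: the monoid `U(X)` with an absorbing element `b = ⊤` (the
constant function `∞`) adjoined, ordered by the dual of the pointwise order. So the
zero function is both the identity and the greatest element, and `b` is the least element. -/
abbrev UscLattice : Type _ := Multiplicative (WithTop (UscFun X))ᵒᵈ

end UpperSemicontinuousFunctions

/-! Condition (4) is the hub, reached from (1) through (3) and directly from (5). That nonzero
primes are maximal is the hard point of both routes: in
`IsPrime.isMaximal_of_forall_isProdOfRadicals` and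
`IsPrime.isMaximal_of_forall_isInvertibleIdeal_radical`, a nonzero nonmaximal prime produces an
invertible ideal equal to a proper multiple of itself.

Under (4) the localizations at nonzero maximal ideals are discrete valuation rings, so a nonzero
ideal is determined by its orders `M.ord I`: products add orders, inclusion reverses them
(`le_iff`), and radical means order at most 1 everywhere. Compactness of `V(I)`
(`exists_finset_forall_exists_le`) patches local data into invertible radicals, which gives (7) and
then (5).

Under (5) every nonzero ideal is divisible by its radical (`exists_eq_radical_mul`). Iterating this
gives the chain in (2) and shows that orders are upper semicontinuous. Conversely, closed compact
sets are vanishing sets of radical ideals and functions in `U(X)` are sums of characteristic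
functions, so every such function occurs, which gives (6). Both (2) and (6) lead back to (1). -/

namespace Ideal

/-! ### Invertible ideals: divisibility and cancellation. -/

section Invertible

variable {R : Type*} [CommRing R] {I J A B C : Ideal R}

theorem IsRadical.le_of_mul_self_le (hI : I.IsRadical) (h : J * J ≤ I) : J ≤ I :=
  fun x hx => hI ⟨2, by rw [pow_two]; exact h (mul_mem_mul hx hx)⟩

/-- Only products and inclusions of ideals appear here, so radicality can be read off from the
multiplicative lattice. -/
theorem isRadical_iff_forall_mul_self_le : I.IsRadical ↔ ∀ J : Ideal R, J * J ≤ I → J ≤ I := by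
  refine ⟨fun h J => h.le_of_mul_self_le, fun h => isRadical_iff_pow_one_lt 2 one_lt_two |>.2
    fun x hx => ?_⟩
  rw [← span_singleton_le_iff_mem]
  apply h
  rwa [span_singleton_mul_span_singleton, span_singleton_le_iff_mem, ← pow_two]

theorem isInvertibleIdeal_mul_iff :
    (A * B).IsInvertibleIdeal ↔ A.IsInvertibleIdeal ∧ B.IsInvertibleIdeal := by
  unfold IsInvertibleIdeal
  rw [FractionalIdeal.coeIdeal_mul, IsUnit.mul_iff]

theorem IsInvertibleIdeal.fg (h : I.IsInvertibleIdeal) : I.FG :=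
  I.fg_of_isUnit (IsFractionRing.injective R (FractionRing R)) h

theorem exists_eq_span_singleton_mul_of_le {a : R} (h : B ≤ span {a}) :
    ∃ D : Ideal R, B = span {a} * D := by
  refine ⟨Submodule.comap (LinearMap.mulLeft R a) B, le_antisymm (fun b hb => ?_) ?_⟩
  · obtain ⟨c, rfl⟩ := mem_span_singleton'.1 (h hb)
    rw [mul_comm c a]
    exact mul_mem_mul (mem_span_singleton_self a) (by simpa [Submodule.mem_comap, mul_comm] using hb)
  · rw [span_singleton_mul_le_iff]
    intro z hz
    simpa using hz

variable [IsDomain R]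

/-- Clearing the denominator of the inverse leaves a statement about integral ideals; divisibility
and cancellation then reduce to principal ideals. -/
theorem isInvertibleIdeal_iff_exists_mul_eq_span :
    I.IsInvertibleIdeal ↔ ∃ (J : Ideal R) (a : R), a ≠ 0 ∧ I * J = span {a} := by
  constructor
  · intro h
    unfold IsInvertibleIdeal at h
    obtain ⟨F, hF⟩ := h.exists_right_inv
    obtain ⟨a, J, ha, hFJ⟩ := FractionalIdeal.exists_eq_spanSingleton_mul F
    refine ⟨J, a, ha, ?_⟩
    apply FractionalIdeal.coeIdeal_injective (K := FractionRing R)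
    beta_reduce
    have ha' : algebraMap R (FractionRing R) a ≠ 0 := by simpa using ha
    rw [FractionalIdeal.coeIdeal_mul, FractionalIdeal.coeIdeal_span_singleton]
    have : FractionalIdeal.spanSingleton R⁰ (algebraMap R (FractionRing R) a) *
        ((I : FractionalIdeal R⁰ (FractionRing R)) * F) =
        FractionalIdeal.spanSingleton R⁰ (algebraMap R (FractionRing R) a) := by
      rw [hF, mul_one]
    rw [hFJ, mul_left_comm, ← mul_assoc (FractionalIdeal.spanSingleton R⁰ _),
      FractionalIdeal.spanSingleton_mul_spanSingleton, mul_inv_cancel₀ ha',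
      FractionalIdeal.spanSingleton_one, one_mul] at this
    exact this
  · rintro ⟨J, a, ha, h⟩
    have ha' : algebraMap R (FractionRing R) a ≠ 0 := by simpa using ha
    refine IsUnit.of_mul_eq_one
      ((J : FractionalIdeal R⁰ (FractionRing R)) *
        FractionalIdeal.spanSingleton R⁰ (algebraMap R (FractionRing R) a)⁻¹) ?_
    rw [← mul_assoc, ← FractionalIdeal.coeIdeal_mul, h, FractionalIdeal.coeIdeal_span_singleton,
      FractionalIdeal.spanSingleton_mul_spanSingleton, mul_inv_cancel₀ ha',
      FractionalIdeal.spanSingleton_one]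

theorem isInvertibleIdeal_span_singleton {a : R} (ha : a ≠ 0) :
    (span {a}).IsInvertibleIdeal :=
  isInvertibleIdeal_iff_exists_mul_eq_span.2 ⟨⊤, a, ha, mul_top _⟩

theorem IsInvertibleIdeal.ne_bot (h : I.IsInvertibleIdeal) : I ≠ ⊥ := by
  rintro rfl
  obtain ⟨J, a, ha, h⟩ := isInvertibleIdeal_iff_exists_mul_eq_span.1 h
  rw [bot_mul, eq_comm, span_singleton_eq_bot] at h
  exact ha h

theorem IsInvertibleIdeal.exists_eq_mul_of_le (hA : A.IsInvertibleIdeal) (h : B ≤ A) :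
    ∃ D : Ideal R, B = A * D := by
  obtain ⟨J, a, ha, hJ⟩ := isInvertibleIdeal_iff_exists_mul_eq_span.1 hA
  obtain ⟨D, hD⟩ := exists_eq_span_singleton_mul_of_le (a := a) (B := B * J)
    (hJ ▸ mul_mono_left h)
  refine ⟨D, (span_singleton_mul_right_inj ha).1 ?_⟩
  calc span {a} * B = A * (B * J) := by rw [← hJ]; ring
    _ = span {a} * (A * D) := by rw [hD]; ring

theorem IsInvertibleIdeal.le_of_mul_le_mul_left (hA : A.IsInvertibleIdeal)
    (h : A * B ≤ A * C) : B ≤ C := by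
  obtain ⟨J, a, ha, hJ⟩ := isInvertibleIdeal_iff_exists_mul_eq_span.1 hA
  refine (span_singleton_mul_right_mono ha).1 ?_
  rw [← hJ, mul_comm A J, mul_assoc, mul_assoc]
  exact mul_mono_right h

end Invertible

/-! ### Dimension one from invertible radicals. -/

section RadicalsInvertible

variable {R : Type*} [CommRing R] [IsDomain R]

/-- If the radicals of the nonzero finitely generated ideals are invertible, then every nonzero
prime ideal is maximal. -/
theorem IsPrime.isMaximal_of_forall_isInvertibleIdeal_radical
    (h : ∀ I : Ideal R, I ≠ ⊥ → I.FG → I.radical.IsInvertibleIdeal)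
    {P : Ideal R} (hP : P.IsPrime) (hP0 : P ≠ ⊥) : P.IsMaximal := by
  obtain ⟨M, hM, hPM⟩ := P.exists_le_maximal hP.ne_top
  by_cases hMP : M ≤ P
  · rwa [le_antisymm hPM hMP]
  exfalso
  obtain ⟨a, haP, ha0⟩ := Submodule.exists_mem_ne_zero_of_ne_bot hP0
  obtain ⟨b, hbM, hbP⟩ := SetLike.not_le_iff_exists.1 hMP
  have fg_span : (span {a, b} : Ideal R).FG := Submodule.fg_span (by simp)
  have span_ne : (span {a, b} : Ideal R) ≠ ⊥ := fun h0 => ha0 <| by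
    have : a ∈ (span {a, b} : Ideal R) := subset_span (by simp)
    rwa [h0] at this
  have hX := h (span {a}) (by simpa using ha0) ⟨{a}, by simp⟩
  have hZ := h _ span_ne fg_span
  set X := (span {a}).radical with hXdef
  set Z := (span {a, b}).radical with hZdef
  have hXZ : X ≤ Z := radical_mono (span_mono (by simp))
  obtain ⟨W, hW⟩ := hZ.exists_eq_mul_of_le hXZ
  have hXP : X ≤ P := hP.radical_le_iff.2 ((span_singleton_le_iff_mem _).2 haP)
  have hZP : ¬ Z ≤ P := fun hle => hbP (hle (le_radical (subset_span (by simp))))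
  have hZM : Z ≤ M := hM.isPrime.radical_le_iff.2 <| span_le.2 <| by
    rintro x (rfl | rfl)
    exacts [hPM haP, hbM]
  have hWP : W ≤ P := ((hP.mul_le).1 (hW ▸ hXP)).resolve_left hZP
  have hWinv : W.IsInvertibleIdeal := (isInvertibleIdeal_mul_iff.1 (hW ▸ hX)).2
  -- Both factors of `X = Z * W` lie in `M`, so their common divisor `T` does too. Then `T ^ 2`
  -- divides the radical ideal `X`, which is impossible unless `T = ⊤`.
  have hT := h (Z ⊔ W) (ne_bot_of_le_ne_bot hZ.ne_bot le_sup_left) (Submodule.FG.sup hZ.fg hWinv.fg)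
  set T := (Z ⊔ W).radical with hTdef
  have hTM : T ≤ M := hM.isPrime.radical_le_iff.2 (sup_le hZM (hWP.trans hPM))
  obtain ⟨Z', hZ'⟩ := hT.exists_eq_mul_of_le (le_sup_left.trans le_radical : Z ≤ T)
  obtain ⟨W', hW'⟩ := hT.exists_eq_mul_of_le (le_sup_right.trans le_radical : W ≤ T)
  have hX' : X = (T * Z' * W') * T := by rw [hW, hZ', hW']; ring
  have hle : T * Z' * W' ≤ X := by
    apply (radical_isRadical (span {a})).le_of_mul_self_le
    calc T * Z' * W' * (T * Z' * W') = X * (Z' * W') := by rw [hX']; ring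
      _ ≤ X := mul_le_left
  have htop : ⊤ ≤ T := by
    refine (isInvertibleIdeal_mul_iff.1 (hX' ▸ hX)).1.le_of_mul_le_mul_left ?_
    rwa [mul_top, ← hX']
  exact hM.ne_top (top_le_iff.1 (htop.trans hTM))

end RadicalsInvertible

end Ideal

namespace Ideal

/-! ### Dimension one from factorization into radical ideals. -/

section AllProducts

variable {R : Type*} [CommRing R]

/-- Divisibility is the point: if `I` is invertible, so is the factor found. -/
theorem IsProdOfRadicals.exists_isRadical_le {I P : Ideal R} (hP : P.IsPrime)
    (h : I.IsProdOfRadicals) (hle : I ≤ P) : ∃ J, J.IsRadical ∧ J ≤ P ∧ J ∣ I := by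
  obtain ⟨l, hl, rfl⟩ := h
  induction l with
  | nil => exact absurd (top_le_iff.1 (by simpa using hle)) hP.ne_top
  | cons J l ih =>
    rw [List.prod_cons] at hle
    rcases hP.mul_le.1 hle with h | h
    · exact ⟨J, hl J (by simp), h, by simp⟩
    · obtain ⟨K, hK, hKP, hd⟩ := ih (fun J hJ => hl J (by simp [hJ])) h
      exact ⟨K, hK, hKP, hd.trans (by simp)⟩

/-- Every ideal of the localization is extended from its contraction, and extension preserves
products and radical ideals. -/
theorem isProdOfRadicals_localization (h : ∀ I : Ideal R, I ≠ ⊤ → I.IsProdOfRadicals)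
    (S : Submonoid R) (A : Type*) [CommRing A] [Algebra R A] [IsLocalization S A]
    (I : Ideal A) (hI : I ≠ ⊤) : I.IsProdOfRadicals := by
  obtain ⟨l, hl, hlI⟩ := h (I.comap (algebraMap R A)) (comap_ne_top _ hI)
  refine ⟨l.map (map (algebraMap R A)), ?_, ?_⟩
  · intro J hJ
    obtain ⟨K, hK, rfl⟩ := List.mem_map.1 hJ
    rw [← (hl K hK).radical, IsLocalization.map_radical S]
    exact radical_isRadical _
  · refine .trans ?_ (IsLocalization.map_under S A I)
    rw [under_def, ← hlI]
    exact (map_list_prod (mapHom (algebraMap R A)) l).symm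

/-- In a local ring, a product of radical ideals that is not contained in the square of the
maximal ideal is radical. -/
theorem IsProdOfRadicals.isRadical_of_not_le_sq [IsLocalRing R] {I : Ideal R}
    (h : I.IsProdOfRadicals) (hI : ¬ I ≤ IsLocalRing.maximalIdeal R ^ 2) : I.IsRadical := by
  obtain ⟨l, hl, rfl⟩ := h
  induction l with
  | nil => exact fun x _ => by simp [one_eq_top]
  | cons J l ih =>
    rw [List.prod_cons] at hI ⊢
    rcases eq_or_ne J ⊤ with rfl | hJ
    · rw [top_mul] at hI ⊢
      exact ih (fun J hJ => hl J (by simp [hJ])) hI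
    rcases eq_or_ne l.prod ⊤ with hp | hp
    · rw [hp, mul_top]
      exact hl J (by simp)
    · exact absurd (by
        rw [pow_two]
        exact mul_mono (IsLocalRing.le_maximalIdeal hJ) (IsLocalRing.le_maximalIdeal hp)) hI

variable [IsDomain R]

/-- Some `c` in `M` lies outside `M ^ 2 ⊔ P`. Radicality of the ideals `(c, x ^ 2)` gives `P = c P`,
and an invertible radical `J ≤ P` then satisfies `J = c J`, making `c` a unit. -/
theorem not_maximalIdeal_minimalPrimes_of_isProdOfRadicals [IsLocalRing R]
    (h : ∀ I : Ideal R, I ≠ ⊤ → I.IsProdOfRadicals) {P : Ideal R} (hP : P.IsPrime)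
    (hP0 : P ≠ ⊥) {b : R} (hbP : b ∉ P)
    (hmin : IsLocalRing.maximalIdeal R ∈ (P ⊔ span {b}).minimalPrimes) : False := by
  set M := IsLocalRing.maximalIdeal R with hM
  have hMmax : M.IsMaximal := IsLocalRing.maximalIdeal.isMaximal R
  have hPM : P ≤ M := le_sup_left.trans hmin.1.2
  have hbM : b ∈ M := hmin.1.2 (mem_sup_right (mem_span_singleton_self b))
  -- every radical ideal containing `P + (b)` is `M` or `R`, so `P + (b)` is a power of `M`
  have hpow : ∃ n, P ⊔ span {b} = M ^ n := by
    obtain ⟨l, hl, hlI⟩ := h (P ⊔ span {b})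
      (ne_top_of_le_ne_top hMmax.ne_top hmin.1.2)
    have hl' : ∀ J ∈ l, J = M ∨ J = ⊤ := by
      intro J hJ
      by_contra! hcon
      have hle : P ⊔ span {b} ≤ J := by
        rw [← hlI]
        exact le_of_dvd (List.dvd_prod hJ)
      have hlt : ¬ M ≤ J := fun hMJ => hcon.1 (hMmax.eq_of_le hcon.2 hMJ).symm
      apply hlt
      rw [← (hl J hJ).radical, radical_eq_sInf]
      refine le_sInf fun Q hQ => hmin.2 ⟨hQ.2, hle.trans hQ.1⟩ (IsLocalRing.le_maximalIdeal hQ.2.ne_top)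
    rw [← hlI]
    clear hlI hl
    induction l with
    | nil => exact ⟨0, by simp⟩
    | cons J l ih =>
      obtain ⟨n, hn⟩ := ih fun J hJ => hl' J (by simp [hJ])
      rw [List.prod_cons, hn]
      rcases hl' J (by simp) with rfl | rfl
      · exact ⟨n + 1, by rw [pow_succ']⟩
      · exact ⟨n, by simp⟩
  -- Otherwise `M` is idempotent modulo `P`, and so is its power `P ⊔ span {b}`; this puts `b` in
  -- `(b ^ 2) + P`.
  have hMP : ¬ M ≤ M ^ 2 ⊔ P := by
    intro hle
    obtain ⟨n, hn⟩ := hpow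
    have hpow' : ∀ k, M ≤ M ^ (k + 1) ⊔ P := by
      intro k
      induction k with
      | zero => simp
      | succ k ih =>
        calc M ≤ M ^ 2 ⊔ P := hle
          _ ≤ M * (M ^ (k + 1) ⊔ P) ⊔ P := by
            rw [pow_two]
            exact sup_le_sup_right (mul_mono_right ih) _
          _ ≤ M ^ (k + 2) ⊔ P := by
            rw [mul_sup, ← pow_succ']
            exact sup_le (sup_le le_sup_left (mul_le_right.trans le_sup_right)) le_sup_right
    have hb2 : b ∈ span {b * b} ⊔ P := by
      have h1 : M ≤ P ⊔ span {b} * (P ⊔ span {b}) := by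
        rcases Nat.eq_zero_or_pos n with rfl | hn0
        · rw [pow_zero, one_eq_top] at hn
          exact absurd (top_le_iff.1 (hn ▸ hmin.1.2)) hMmax.ne_top
        obtain ⟨m, rfl⟩ := Nat.exists_eq_succ_of_ne_zero hn0.ne'
        -- The exponent is twice `m + 1`, so the power is the square of `P ⊔ span {b}`.
        calc M ≤ M ^ (m + m + 1 + 1) ⊔ P := hpow' _
          _ = (P ⊔ span {b}) * (P ⊔ span {b}) ⊔ P := by rw [hn, ← pow_add]; congr 2; lia
          _ ≤ _ := by
            rw [sup_mul]
            exact sup_le (sup_le (mul_le_left.trans le_sup_left) le_sup_right) le_sup_left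
      have h2 : P ⊔ span {b} * (P ⊔ span {b}) ≤ span {b * b} ⊔ P := by
        rw [mul_sup, span_singleton_mul_span_singleton]
        exact sup_le le_sup_right (sup_le (mul_le_right.trans le_sup_right) le_sup_left)
      exact h2 (h1 hbM)
    obtain ⟨y, hy, p, hp, hyp⟩ := Submodule.mem_sup.1 hb2
    obtain ⟨r, rfl⟩ := mem_span_singleton'.1 hy
    have hmem : b * (1 - r * b) ∈ P := by
      convert hp using 1
      linear_combination -hyp
    refine hMmax.ne_top (eq_top_of_isUnit_mem _ (hPM ((hP.mem_or_mem hmem).resolve_left hbP)) ?_)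
    exact (IsLocalRing.isUnit_or_isUnit_one_sub_self (r * b)).resolve_left
      fun hu => hMmax.ne_top (eq_top_of_isUnit_mem _ (M.mul_mem_left r hbM) hu)
  obtain ⟨c, hcM, hc⟩ := SetLike.not_le_iff_exists.1 hMP
  have hcP : c ∉ P := fun hcP => hc (mem_sup_right hcP)
  -- for `x ∈ P` the ideal `(c, x²)` is radical
  have hPc : ∀ x ∈ P, ∃ z ∈ P, x = c * z := by
    intro x hx
    have hle : span {c} ⊔ span {x ^ 2} ≤ M :=
      sup_le ((span_singleton_le_iff_mem _).2 hcM)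
        ((span_singleton_le_iff_mem _).2 (pow_mem_of_mem _ (hPM hx) 2 two_pos))
    have hrad := (h _ (ne_top_of_le_ne_top hMmax.ne_top hle)).isRadical_of_not_le_sq
      fun hle2 => hc (mem_sup_left (hle2 (mem_sup_left (mem_span_singleton_self c))))
    have hxmem : x ∈ span {c} ⊔ span {x ^ 2} :=
      hrad ⟨2, mem_sup_right (mem_span_singleton_self _)⟩
    obtain ⟨y, hy, w, hw, hyw⟩ := Submodule.mem_sup.1 hxmem
    obtain ⟨s, rfl⟩ := mem_span_singleton'.1 hy
    obtain ⟨t, rfl⟩ := mem_span_singleton'.1 hw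
    have hu : IsUnit (1 - t * x) := (IsLocalRing.isUnit_or_isUnit_one_sub_self (t * x)).resolve_left
      fun hu => hMmax.ne_top (eq_top_of_isUnit_mem _ (M.mul_mem_left t (hPM hx)) hu)
    obtain ⟨u, hu⟩ := hu.exists_right_inv
    have hxz : x = c * (s * u) := by linear_combination x * hu.symm - u * hyw
    exact ⟨s * u, (hP.mem_or_mem (hxz ▸ hx)).resolve_left hcP, hxz⟩
  obtain ⟨a, haP, ha0⟩ := Submodule.exists_mem_ne_zero_of_ne_bot hP0
  have haP' : span {a} ≤ P := (span_singleton_le_iff_mem _).2 haP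
  obtain ⟨J, hJ, hJP, hJa⟩ := (h (span {a})
    (ne_top_of_le_ne_top hP.ne_top haP')).exists_isRadical_le hP haP'
  have hJinv : J.IsInvertibleIdeal := by
    obtain ⟨K, hK⟩ := hJa
    exact (isInvertibleIdeal_mul_iff.1 (hK ▸ isInvertibleIdeal_span_singleton ha0)).1
  have hJM : J ≤ span {c} * J := by
    have hJc : J ≤ span {c} := fun x hx => by
      obtain ⟨z, -, rfl⟩ := hPc x (hJP hx)
      exact mem_span_singleton.2 (dvd_mul_right c z)
    obtain ⟨D, hD⟩ := exists_eq_span_singleton_mul_of_le hJc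
    have hDP : D ≤ P := (hP.mul_le.1 (hD ▸ hJP)).resolve_left
      fun hle => hcP (hle (mem_span_singleton_self c))
    have hDc : D ≤ span {c} := fun x hx => by
      obtain ⟨z, -, rfl⟩ := hPc x (hDP hx)
      exact mem_span_singleton.2 (dvd_mul_right c z)
    have hDJ : D ≤ J := hJ.le_of_mul_self_le (by
      conv_rhs => rw [hD]
      exact mul_mono_left hDc)
    conv_lhs => rw [hD]
    exact mul_mono_right hDJ
  have : (⊤ : Ideal R) ≤ span {c} := by
    refine hJinv.le_of_mul_le_mul_left ?_
    rwa [mul_top, mul_comm]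
  exact hMmax.ne_top (top_le_iff.1 (this.trans ((span_singleton_le_iff_mem _).2 hcM)))

/-- If every proper ideal is a product of radical ideals, then every nonzero prime ideal is
maximal. -/
theorem IsPrime.isMaximal_of_forall_isProdOfRadicals
    (h : ∀ I : Ideal R, I ≠ ⊤ → I.IsProdOfRadicals) {P : Ideal R} (hP : P.IsPrime)
    (hP0 : P ≠ ⊥) : P.IsMaximal := by
  obtain ⟨M, hM, hPM⟩ := P.exists_le_maximal hP.ne_top
  by_cases hMP : M ≤ P
  · rwa [le_antisymm hPM hMP]
  exfalso
  obtain ⟨b, hbM, hbP⟩ := SetLike.not_le_iff_exists.1 hMP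
  have := hM.isPrime
  -- Localizing at a prime `N` minimal over `P + (b)` makes the maximal ideal minimal over the
  -- extension of `P + (b)`.
  obtain ⟨N, hN, -⟩ := exists_minimalPrimes_le
    (sup_le hPM ((span_singleton_le_iff_mem _).2 hbM) : P ⊔ span {b} ≤ M)
  have hNp : N.IsPrime := hN.1.1
  have hPN : P ≤ N := le_sup_left.trans hN.1.2
  let A := Localization.AtPrime N
  have hdisj : Disjoint (N.primeCompl : Set R) (P : Set R) :=
    Set.disjoint_left.2 fun x hx hxP => hx (hPN hxP)
  have hcomap : (P.map (algebraMap R A)).comap (algebraMap R A) = P :=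
    IsLocalization.under_map_of_isPrime_disjoint N.primeCompl A hP hdisj
  refine not_maximalIdeal_minimalPrimes_of_isProdOfRadicals (R := A)
    (isProdOfRadicals_localization h N.primeCompl A) (P := P.map (algebraMap R A))
    (IsLocalization.isPrime_of_isPrime_disjoint N.primeCompl A P hP hdisj)
    ?_ (b := algebraMap R A b) ?_ ⟨⟨inferInstance, ?_⟩, ?_⟩
  · rwa [Ne, map_eq_bot_iff_of_injective (IsLocalization.injective A N.primeCompl_le_nonZeroDivisors)]
  · intro hb
    exact hbP (hcomap ▸ mem_comap.2 hb)
  · rw [← IsLocalization.AtPrime.map_eq_maximalIdeal N A, sup_le_iff, span_singleton_le_iff_mem]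
    exact ⟨map_mono hPN, mem_map_of_mem _ (hN.1.2 (mem_sup_right (mem_span_singleton_self b)))⟩
  · rintro Q ⟨hQ, hQle⟩ -
    rw [← IsLocalization.AtPrime.map_eq_maximalIdeal N A, map_le_iff_le_comap]
    refine hN.2 ⟨hQ.comap _, ?_⟩ ?_
    · rw [sup_le_iff, ← map_le_iff_le_comap, span_singleton_le_iff_mem, mem_comap]
      exact ⟨le_sup_left.trans hQle, hQle (mem_sup_right (mem_span_singleton_self _))⟩
    · exact (comap_mono (IsLocalRing.le_maximalIdeal hQ.ne_top)).trans_eq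
        (IsLocalization.AtPrime.under_maximalIdeal A N)

end AllProducts

end Ideal

/-! ### Almost Dedekind domains and orders of ideals. -/

section Order

open IsLocalRing Ideal

variable {R : Type*} [CommRing R]

instance MaxInv.isMaximal (M : MaxInv R) : M.1.IsMaximal := M.2.1

/-- The localization of `R` at a nonzero maximal ideal. -/
abbrev MaxInv.Loc (M : MaxInv R) : Type _ := Localization.AtPrime M.1

variable (R) in
/-- The localizations at the nonzero maximal ideals are discrete valuation rings. -/
def IsAlmostDedekind [IsDomain R] : Prop :=
  ∀ M : MaxInv R, IsDiscreteValuationRing M.Loc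

open Classical in
/-- The exponent `n` with `I R_M = (M R_M) ^ n`. -/
noncomputable def MaxInv.ord (M : MaxInv R) (I : Ideal R) : ℕ :=
  -- When the localization is a discrete valuation ring, only the zero ideal falls under the
  -- default; hence the hypotheses `I ≠ ⊥` below.
  if h : ∃ n, I.map (algebraMap R M.Loc) = maximalIdeal M.Loc ^ n then h.choose else 0

variable [IsDomain R]

/-- In the one-dimensional local domain `R_M` the extension of `J` is radical and nonzero, hence the
maximal ideal. It is also invertible, hence principal, so all primes of `R_M` are principal. -/
theorem isAlmostDedekind_of_exists_isInvertibleIdeal_isRadical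
    (hdim : ∀ P : Ideal R, P.IsPrime → P ≠ ⊥ → P.IsMaximal)
    (hJ : ∀ P : Ideal R, P.IsPrime → P ≠ ⊥ →
      ∃ J : Ideal R, J ≤ P ∧ J.IsInvertibleIdeal ∧ J.IsRadical) :
    IsAlmostDedekind R := by
  intro M
  have : Ring.DimensionLEOne R := ⟨fun h0 hp => hdim _ hp h0⟩
  have hS := M.1.primeCompl_le_nonZeroDivisors
  have : Ring.DimensionLEOne M.Loc := .localization _ hS
  have hinj : Function.Injective (algebraMap R M.Loc) := IsLocalization.injective _ hS
  obtain ⟨J, hJM, hJinv, hJrad⟩ := hJ M.1 M.2.1.isPrime M.2.2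
  have hm0 : maximalIdeal M.Loc ≠ ⊥ := by
    rw [← IsLocalization.AtPrime.map_eq_maximalIdeal M.1 M.Loc, Ne, map_eq_bot_iff_of_injective hinj]
    exact M.2.2
  have hmap : J.map (algebraMap R M.Loc) = maximalIdeal M.Loc := by
    refine le_antisymm ?_ ?_
    · rw [← IsLocalization.AtPrime.map_eq_maximalIdeal M.1 M.Loc]
      exact map_mono hJM
    · rw [← hJrad.radical, IsLocalization.map_radical M.1.primeCompl, radical_eq_sInf]
      refine le_sInf fun Q ⟨hJQ, hQ⟩ => ?_
      have hQ0 : Q ≠ ⊥ := ne_bot_of_le_ne_bot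
        (by rw [Ne, map_eq_bot_iff_of_injective hinj]; exact hJinv.ne_bot) hJQ
      exact (eq_maximalIdeal (hQ.isMaximal hQ0)).ge
  have hprin : (maximalIdeal M.Loc).IsPrincipal := by
    apply Ideal.IsPrincipal.of_finite_maximals_of_isUnit
    · refine (Set.finite_singleton (maximalIdeal M.Loc)).subset fun Q hQ => eq_maximalIdeal hQ
    · obtain ⟨K, a, ha, h⟩ := isInvertibleIdeal_iff_exists_mul_eq_span.1 hJinv
      refine isInvertibleIdeal_iff_exists_mul_eq_span.2
        ⟨K.map (algebraMap R M.Loc), algebraMap R M.Loc a, ?_, ?_⟩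
      · rwa [Ne, map_eq_zero_iff _ hinj]
      · rw [← hmap, ← Ideal.map_mul, h, map_span, Set.image_singleton]
  have : IsPrincipalIdealRing M.Loc := .of_prime_ne_bot fun Q hQ hQ0 => by
    rwa [eq_maximalIdeal (hQ.isMaximal hQ0)]
  exact { not_a_field' := hm0 }

namespace IsAlmostDedekind

variable (hR : IsAlmostDedekind R) (M : MaxInv R) {I J : Ideal R}
include hR

theorem map_eq_pow_ord (hI : I ≠ ⊥) :
    I.map (algebraMap R M.Loc) = maximalIdeal M.Loc ^ M.ord I := by
  have := hR M
  have h : ∃ n, I.map (algebraMap R M.Loc) = maximalIdeal M.Loc ^ n := by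
    obtain ⟨n, hn⟩ := (IsDiscreteValuationRing.idealOrderIsoENat M.Loc).symm.surjective
      (I.map (algebraMap R M.Loc))
    obtain ⟨n, rfl⟩ := OrderDual.toDual.surjective n
    induction n using ENat.recTopCoe with
    | top =>
      refine absurd ?_ hI
      rw [← map_eq_bot_iff_of_injective
        (IsLocalization.injective M.Loc M.1.primeCompl_le_nonZeroDivisors), ← hn]
      rfl
    | coe n => exact ⟨n, hn.symm⟩
  rw [MaxInv.ord, dif_pos h]
  exact h.choose_spec

theorem pow_le_pow_iff {m n : ℕ} :
    maximalIdeal M.Loc ^ m ≤ maximalIdeal M.Loc ^ n ↔ n ≤ m := by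
  have := hR M
  rw [← IsDiscreteValuationRing.idealOrderIsoENat_symm_apply_coe,
    ← IsDiscreteValuationRing.idealOrderIsoENat_symm_apply_coe, OrderIso.le_iff_le]
  exact Nat.cast_le (α := ℕ∞)

theorem le_ord_iff (hI : I ≠ ⊥) {k : ℕ} :
    k ≤ M.ord I ↔ I.map (algebraMap R M.Loc) ≤ maximalIdeal M.Loc ^ k := by
  rw [hR.map_eq_pow_ord M hI, hR.pow_le_pow_iff]

theorem map_le_map_iff (hI : I ≠ ⊥) (hJ : J ≠ ⊥) :
    I.map (algebraMap R M.Loc) ≤ J.map (algebraMap R M.Loc) ↔ M.ord J ≤ M.ord I := by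
  rw [hR.map_eq_pow_ord M hJ, hR.le_ord_iff M hI]

theorem ord_anti (hI : I ≠ ⊥) (h : I ≤ J) : M.ord J ≤ M.ord I :=
  (hR.map_le_map_iff M hI (ne_bot_of_le_ne_bot hI h)).1 (map_mono h)

theorem ord_mul (hI : I ≠ ⊥) (hJ : J ≠ ⊥) : M.ord (I * J) = M.ord I + M.ord J := by
  have hIJ : I * J ≠ ⊥ := by simp [hI, hJ]
  have h : maximalIdeal M.Loc ^ M.ord (I * J) = maximalIdeal M.Loc ^ (M.ord I + M.ord J) := by
    rw [pow_add, ← hR.map_eq_pow_ord M hI, ← hR.map_eq_pow_ord M hJ, ← hR.map_eq_pow_ord M hIJ,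
      Ideal.map_mul]
  exact le_antisymm ((hR.pow_le_pow_iff M).1 h.ge) ((hR.pow_le_pow_iff M).1 h.le)

theorem ord_pow (hI : I ≠ ⊥) (n : ℕ) : M.ord (I ^ n) = n * M.ord I := by
  induction n with
  | zero =>
    rw [pow_zero, zero_mul, ← Nat.le_zero]
    refine (hR.pow_le_pow_iff M).1 ?_
    rw [← hR.map_eq_pow_ord M (by simp), one_eq_top, Ideal.map_top, pow_zero, one_eq_top]
  | succ n ih => rw [pow_succ, hR.ord_mul M (pow_ne_zero n hI) hI, ih]; ring

theorem one_le_ord_iff (hI : I ≠ ⊥) : 1 ≤ M.ord I ↔ I ≤ M.1 := by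
  rw [hR.le_ord_iff M hI, pow_one, map_le_iff_le_comap]
  exact iff_of_eq (congrArg (I ≤ ·) (IsLocalization.AtPrime.under_maximalIdeal M.Loc M.1))

theorem ord_eq_zero_iff (hI : I ≠ ⊥) : M.ord I = 0 ↔ ¬ I ≤ M.1 := by
  rw [← hR.one_le_ord_iff M hI]; lia

theorem ord_le_one_of_isRadical (hI : I ≠ ⊥) (h : I.IsRadical) : M.ord I ≤ 1 := by
  have hrad : (I.map (algebraMap R M.Loc)).IsRadical := by
    rw [← h.radical, IsLocalization.map_radical M.1.primeCompl]
    exact radical_isRadical _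
  rcases Nat.eq_zero_or_pos (M.ord I) with h0 | h0
  · lia
  refine (hR.pow_le_pow_iff M).1 ?_
  rw [hR.map_eq_pow_ord M hI] at hrad
  intro x hx
  exact hrad ⟨M.ord I, pow_mem_pow (by simpa using hx) _⟩

omit hR M in
theorem le_iff (hR : IsAlmostDedekind R) (hI : I ≠ ⊥) (hJ : J ≠ ⊥) :
    I ≤ J ↔ ∀ M : MaxInv R, M.ord J ≤ M.ord I := by
  refine ⟨fun h M => hR.ord_anti M hI h, fun h => le_of_localization_maximal fun P hP => ?_⟩
  -- The zero ideal is maximal only if `R` is a field, and then `J = ⊤`.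
  rcases eq_or_ne P ⊥ with rfl | hP0
  · rw [hP.out.2 _ (bot_lt_iff_ne_bot.2 hJ), Ideal.map_top]
    exact le_top
  · exact (hR.map_le_map_iff ⟨P, hP, hP0⟩ hI hJ).2 (h ⟨P, hP, hP0⟩)

omit hR M in
theorem eq_iff (hR : IsAlmostDedekind R) (hI : I ≠ ⊥) (hJ : J ≠ ⊥) :
    I = J ↔ ∀ M : MaxInv R, M.ord I = M.ord J :=
  ⟨by rintro rfl M; rfl, fun h => le_antisymm ((hR.le_iff hI hJ).2 fun M => (h M).ge)
    ((hR.le_iff hJ hI).2 fun M => (h M).le)⟩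

omit hR M in
theorem isRadical_of_ord_le_one (hR : IsAlmostDedekind R) (hI : I ≠ ⊥)
    (h : ∀ M : MaxInv R, M.ord I ≤ 1) : I.IsRadical := by
  rw [isRadical_iff_forall_mul_self_le]
  intro J hJ
  rcases eq_or_ne J ⊥ with rfl | hJ0
  · exact bot_le
  rw [hR.le_iff (by simpa [mul_eq_bot] using hJ0) hI] at hJ
  rw [hR.le_iff hJ0 hI]
  intro M
  have h1 := hJ M
  have h2 := h M
  rw [hR.ord_mul M hJ0 hJ0] at h1
  lia

omit [IsDomain R] hR in
/-- A containment at `M` of a finitely generated ideal can be realized after multiplication by a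
single element outside of `M`. -/
theorem exists_notMem_span_singleton_mul_le (hJ : J.FG)
    (h : J.map (algebraMap R M.Loc) ≤ I.map (algebraMap R M.Loc)) :
    ∃ u ∉ M.1, span {u} * J ≤ I := by
  induction J, hJ using Submodule.fg_induction with
  | singleton x =>
    change (span {x}).map _ ≤ _ at h
    have hx : algebraMap R M.Loc x ∈ I.map (algebraMap R M.Loc) :=
      h (mem_map_of_mem _ (mem_span_singleton_self x))
    rw [IsLocalization.algebraMap_mem_map_algebraMap_iff M.1.primeCompl] at hx
    obtain ⟨u, hu, hux⟩ := hx
    refine ⟨u, hu, ?_⟩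
    change span {u} * span {x} ≤ I
    rwa [span_singleton_mul_span_singleton, span_singleton_le_iff_mem]
  | sup J₁ J₂ _ _ h₁ h₂ =>
    change (J₁ ⊔ J₂ : Ideal R).map _ ≤ _ at h
    rw [Ideal.map_sup, sup_le_iff] at h
    obtain ⟨u₁, hu₁, hle₁⟩ := h₁ h.1
    obtain ⟨u₂, hu₂, hle₂⟩ := h₂ h.2
    refine ⟨u₁ * u₂, fun hm => (M.2.1.isPrime.mem_or_mem hm).elim hu₁ hu₂, ?_⟩
    rw [← span_singleton_mul_span_singleton, Ideal.mul_sup]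
    refine sup_le ?_ ?_
    · rw [mul_comm (span {u₁}), mul_assoc]
      exact mul_le_right.trans hle₁
    · rw [mul_assoc]
      exact mul_le_right.trans hle₂

theorem exists_notMem_span_singleton_mul_le_of_ord_le (hI : I ≠ ⊥) (hJ : J.FG)
    (h : J ≠ ⊥ → M.ord I ≤ M.ord J) : ∃ u ∉ M.1, span {u} * J ≤ I := by
  refine exists_notMem_span_singleton_mul_le M hJ ?_
  rcases eq_or_ne J ⊥ with rfl | hJ0
  · rw [Ideal.map_bot]; exact bot_le
  · exact (hR.map_le_map_iff M hJ0 hI).2 (h hJ0)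

/-- A prime that contains `I` but not `u` must contain `J`. This turns a local order bound into a
statement about vanishing sets. -/
theorem exists_notMem_span_singleton_mul_pow_le (hI : I ≠ ⊥) (hJ : J.FG) (hJM : J ≤ M.1) :
    ∃ u ∉ M.1, span {u} * J ^ M.ord I ≤ I := by
  refine hR.exists_notMem_span_singleton_mul_le_of_ord_le M hI (Ideal.FG.pow hJ) fun hp => ?_
  rcases eq_or_ne J ⊥ with rfl | hJ0
  · rcases Nat.eq_zero_or_pos (M.ord I) with h0 | h0
    · lia
    · exact absurd (zero_pow h0.ne') hp
  · rw [hR.ord_pow M hJ0]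
    exact Nat.le_mul_of_pos_right _ ((hR.one_le_ord_iff M hJ0).2 hJM)

omit hR M in
/-- Compactness of `V(I)` in the inverse topology. -/
theorem exists_finset_forall_exists_le (hR : IsAlmostDedekind R) (hI : I ≠ ⊥) {ι : Type*}
    {B : ι → Ideal R} (hB : ∀ i, (B i).FG) (hcov : ∀ M : MaxInv R, I ≤ M.1 → ∃ i, B i ≤ M.1) :
    ∃ s : Finset ι, ∀ M : MaxInv R, I ≤ M.1 → ∃ i ∈ s, B i ≤ M.1 := by
  classical
  -- The `u` in `T` certify the covering: no maximal ideal contains `I` and all of `T`, so `1` lies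
  -- in `I` plus the span of finitely many `u`, and their indices suffice.
  let T : Set R := {u | ∃ i n, span {u} * B i ^ n ≤ I}
  have htop : I ⊔ span T = ⊤ := by
    by_contra hne
    obtain ⟨M, hM, hle⟩ := exists_le_maximal _ hne
    have hM0 : M ≠ ⊥ := ne_bot_of_le_ne_bot hI (le_sup_left.trans hle)
    obtain ⟨i, hi⟩ := hcov ⟨M, hM, hM0⟩ (le_sup_left.trans hle)
    obtain ⟨u, hu, hle'⟩ := hR.exists_notMem_span_singleton_mul_pow_le ⟨M, hM, hM0⟩ hI (hB i) hi
    exact hu (hle (mem_sup_right (subset_span ⟨i, _, hle'⟩)))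
  obtain ⟨x, hx, y, hy, hxy⟩ := Submodule.mem_sup.1 ((eq_top_iff_one _).1 htop)
  obtain ⟨t, htT, hyt⟩ := Submodule.mem_span_finite_of_mem_span hy
  choose f hf using fun u : t => htT u.2
  refine ⟨t.attach.image f, fun M hIM => ?_⟩
  by_contra! hcon
  refine M.2.1.ne_top ((eq_top_iff_one _).2 ?_)
  rw [← hxy]
  refine add_mem (hIM hx) ((span_le.2 fun u hu => ?_ : span (t : Set R) ≤ M.1) hyt)
  obtain ⟨n, hn⟩ := hf ⟨u, hu⟩
  rcases M.2.1.isPrime.mul_le.1 (hn.trans hIM) with h | h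
  · exact h (mem_span_singleton_self u)
  · exact absurd (M.2.1.isPrime.le_of_pow_le h) (hcon _ (Finset.mem_image_of_mem f (t.mem_attach ⟨u, hu⟩)))

end IsAlmostDedekind

end Order

/-! ### The inverse topology, invertible radicals and vanishing sets. -/

section InverseTopology

open IsLocalRing Ideal

variable {R : Type*} [CommRing R]

theorem MaxInv.isClosed_setOf_le (I : Ideal R) : IsClosed {M : MaxInv R | I ≤ M.1} := by
  rw [← isOpen_compl_iff, isOpen_iff_forall_mem_open]
  intro M hM
  obtain ⟨a, haI, haM⟩ := SetLike.not_le_iff_exists.1 (show ¬ I ≤ M.1 from hM)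
  have htop : M.1 ⊔ span {a} = ⊤ := M.2.1.out.2 _ (left_lt_sup.2 fun h =>
    haM ((span_singleton_le_iff_mem _).1 h))
  obtain ⟨b, hb, c, hc, hbc⟩ := Submodule.mem_sup.1 ((eq_top_iff_one _).1 htop)
  refine ⟨MaxInv.V (span {b}), fun N hN hIN => N.2.1.ne_top ?_,
    TopologicalSpace.isOpen_generateFrom_of_mem ⟨_, ⟨{b}, by simp⟩, rfl⟩,
    (span_singleton_le_iff_mem _).2 hb⟩
  rw [eq_top_iff_one, ← hbc]
  exact add_mem (hN (mem_span_singleton_self b))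
    ((span_singleton_le_iff_mem _).2 (hIN haI) hc)

theorem MaxInv.isOpen_V {I : Ideal R} (hI : I.FG) : IsOpen (MaxInv.V I) :=
  TopologicalSpace.isOpen_generateFrom_of_mem ⟨I, hI, rfl⟩

theorem MaxInv.exists_fg_mem_V_subset {U : Set (MaxInv R)} (hU : IsOpen U) {M : MaxInv R}
    (hM : M ∈ U) : ∃ I : Ideal R, I.FG ∧ M ∈ MaxInv.V I ∧ MaxInv.V I ⊆ U := by
  induction hU with
  | basic U hU =>
    obtain ⟨I, hI, rfl⟩ := hU
    exact ⟨I, hI, hM, subset_rfl⟩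
  | univ => exact ⟨⊥, Submodule.fg_bot, (bot_le : ⊥ ≤ M.1), Set.subset_univ _⟩
  | inter U V _ _ ihU ihV =>
    obtain ⟨I, hI, hMI, hIU⟩ := ihU hM.1
    obtain ⟨J, hJ, hMJ, hJV⟩ := ihV hM.2
    exact ⟨I ⊔ J, Submodule.FG.sup hI hJ, (sup_le hMI hMJ : I ⊔ J ≤ M.1), fun N hN =>
      ⟨hIU (le_sup_left.trans hN : I ≤ N.1), hJV (le_sup_right.trans hN : J ≤ N.1)⟩⟩
  | sUnion S _ ih =>
    obtain ⟨U, hU, hMU⟩ := hM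
    obtain ⟨I, hI, hMI, hIU⟩ := ih U hU hMU
    exact ⟨I, hI, hMI, hIU.trans (Set.subset_sUnion_of_mem hU)⟩

variable [IsDomain R]

namespace IsAlmostDedekind

variable {I J A B : Ideal R}

theorem ord_top (hR : IsAlmostDedekind R) (M : MaxInv R) : M.ord (⊤ : Ideal R) = 0 :=
  (hR.ord_eq_zero_iff M top_ne_bot).2 fun h => M.2.1.ne_top (top_le_iff.1 h)

theorem eq_top_iff (hR : IsAlmostDedekind R) (hI : I ≠ ⊥) :
    I = ⊤ ↔ ∀ M : MaxInv R, M.ord I = 0 := by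
  simp [hR.eq_iff hI top_ne_bot, hR.ord_top]

theorem ord_eq_one_of_isRadical (hR : IsAlmostDedekind R) (M : MaxInv R) (hI : I ≠ ⊥)
    (h : I.IsRadical) (hM : I ≤ M.1) : M.ord I = 1 :=
  le_antisymm (hR.ord_le_one_of_isRadical M hI h) ((hR.one_le_ord_iff M hI).2 hM)

theorem mul_left_cancel (hR : IsAlmostDedekind R) (hA : A ≠ ⊥) (hI : I ≠ ⊥) (hJ : J ≠ ⊥)
    (h : A * I = A * J) : I = J := by
  rw [hR.eq_iff hI hJ]
  intro M
  have := congrArg M.ord h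
  rw [hR.ord_mul M hA hI, hR.ord_mul M hA hJ] at this
  exact Nat.add_left_cancel this

/-- Finitely generated ideals are invertible if every nonzero maximal ideal contains an invertible
radical ideal. -/
theorem isInvertibleIdeal_of_fg (hR : IsAlmostDedekind R)
    (hJ : ∀ M : MaxInv R, ∃ J ≤ M.1, J.IsInvertibleIdeal ∧ J.IsRadical)
    (hI : I ≠ ⊥) (hfg : I.FG) : I.IsInvertibleIdeal := by
  obtain ⟨a, haI, ha0⟩ := Submodule.exists_mem_ne_zero_of_ne_bot hI
  have ha : span {a} ≠ ⊥ := by simpa using ha0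
  have haI' : span {a} ≤ I := (span_singleton_le_iff_mem _).2 haI
  -- This is the colon ideal `(a) : I`, the candidate for `a` times the inverse of `I`.
  let K : Ideal R := sSup {K | K * I ≤ span {a}}
  have hKI : K * I ≤ span {a} := by
    simp only [K, sSup_eq_iSup', Ideal.iSup_mul]
    exact iSup_le fun K => K.2
  have hleK : ∀ L : Ideal R, L * I ≤ span {a} → L ≤ K := fun L hL => le_sSup hL
  have haK : span {a} ≤ K := hleK _ mul_le_left
  have hK0 : K ≠ ⊥ := ne_bot_of_le_ne_bot ha haK
  refine isInvertibleIdeal_iff_exists_mul_eq_span.2 ⟨K, a, ha0, ?_⟩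
  rw [mul_comm]
  refine le_antisymm hKI ((hR.le_iff ha (mul_ne_zero hK0 hI)).2 fun M => ?_)
  obtain ⟨J, hJM, hJinv, hJrad⟩ := hJ M
  have hJ1 := hR.ord_eq_one_of_isRadical M hJinv.ne_bot hJrad hJM
  -- This is the order that `K` should have at `M`. Since `J` has order 1, `J ^ n * I` has the order
  -- of `(a)`, so some `u` outside `M` gives `(u) J ^ n ≤ K`.
  set n := M.ord (span {a}) - M.ord I with hn
  have hle := hR.ord_anti M ha haI'
  have hJn : J ^ n ≠ ⊥ := pow_ne_zero n hJinv.ne_bot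
  obtain ⟨u, hu, huJ⟩ := hR.exists_notMem_span_singleton_mul_le_of_ord_le M ha
    (J := J ^ n * I) (Ideal.FG.mul (Ideal.FG.pow hJinv.fg) hfg) fun _ => by
      rw [hR.ord_mul M hJn hI, hR.ord_pow M hJinv.ne_bot, hJ1]; lia
  have hu0 : span {u} ≠ ⊥ := by
    rw [Ne, span_singleton_eq_bot]
    rintro rfl
    exact hu (zero_mem _)
  have huK : span {u} * J ^ n ≤ K := hleK _ (by rwa [mul_assoc])
  have hKn := hR.ord_anti M (mul_ne_zero hu0 hJn) huK
  rw [hR.ord_mul M hu0 hJn, hR.ord_pow M hJinv.ne_bot, hJ1,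
    (hR.ord_eq_zero_iff M hu0).2 fun h => hu (h (mem_span_singleton_self u))] at hKn
  rw [hR.ord_mul M hK0 hI]
  lia

/-- Orders are 0 or 1, and maximum plus minimum is the sum. Thus an intersection of invertible
radical ideals divides an invertible ideal and is itself invertible. -/
theorem inf_mul_sup_of_isRadical (hR : IsAlmostDedekind R) (hA : A ≠ ⊥) (hB : B ≠ ⊥)
    (hAr : A.IsRadical) (hBr : B.IsRadical) : (A ⊓ B) * (A ⊔ B) = A * B := by
  have hinf : A ⊓ B ≠ ⊥ := ne_bot_of_le_ne_bot (mul_ne_zero hA hB) mul_le_inf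
  have hsup : A ⊔ B ≠ ⊥ := ne_bot_of_le_ne_bot hA le_sup_left
  rw [hR.eq_iff (mul_ne_zero hinf hsup) (mul_ne_zero hA hB)]
  intro M
  rw [hR.ord_mul M hinf hsup, hR.ord_mul M hA hB]
  have h1 := hR.ord_le_one_of_isRadical M hA hAr
  have h2 := hR.ord_le_one_of_isRadical M hB hBr
  have h3 := hR.ord_le_one_of_isRadical M hinf (hAr.inf hBr)
  have h4 := hR.ord_anti M hA (le_sup_left : A ≤ A ⊔ B)
  have i1 := hR.one_le_ord_iff M hA
  have i2 := hR.one_le_ord_iff M hB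
  have i3 := hR.one_le_ord_iff M hinf
  have i4 := hR.one_le_ord_iff M hsup
  rw [M.2.1.isPrime.inf_le, ← i1, ← i2] at i3
  rw [sup_le_iff, ← i1, ← i2] at i4
  lia

/-- By compactness finitely many `B i` have vanishing sets covering that of `I`. Each `I ⊔ B i` is
radical and invertible, and their intersection is the radical of `I`. -/
theorem isInvertibleIdeal_radical_of_fg (hR : IsAlmostDedekind R)
    (hJ : ∀ M : MaxInv R, ∃ J ≤ M.1, J.IsInvertibleIdeal ∧ J.IsRadical)
    (hI : I ≠ ⊥) (hfg : I.FG) : I.radical.IsInvertibleIdeal := by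
  classical
  choose B hBM hBinv hBrad using hJ
  obtain ⟨s, hs⟩ := hR.exists_finset_forall_exists_le hI (B := B) (fun M => (hBinv M).fg)
    fun M _ => ⟨M, hBM M⟩
  have key : ∀ s : Finset (MaxInv R), ∃ A : Ideal R, A.IsInvertibleIdeal ∧ A.IsRadical ∧ I ≤ A ∧
      ∀ M : MaxInv R, I ≤ M.1 → (∃ i ∈ s, B i ≤ M.1) → A ≤ M.1 := by
    intro s
    induction s using Finset.induction with
    | empty =>
      refine ⟨⊤, ?_, (radical_top R).le, le_top, by simp⟩
      rw [← span_singleton_one]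
      exact isInvertibleIdeal_span_singleton one_ne_zero
    | insert N s _ ih =>
      obtain ⟨A, hAinv, hArad, hIA, hA⟩ := ih
      have hK0 : I ⊔ B N ≠ ⊥ := ne_bot_of_le_ne_bot hI le_sup_left
      have hKrad : (I ⊔ B N).IsRadical := hR.isRadical_of_ord_le_one hK0 fun M =>
        (hR.ord_anti M (hBinv N).ne_bot le_sup_right).trans
          (hR.ord_le_one_of_isRadical M (hBinv N).ne_bot (hBrad N))
      have hKinv : (I ⊔ B N).IsInvertibleIdeal := hR.isInvertibleIdeal_of_fg
        (fun M => ⟨B M, hBM M, hBinv M, hBrad M⟩) hK0 (Submodule.FG.sup hfg (hBinv N).fg)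
      refine ⟨A ⊓ (I ⊔ B N), ?_, hArad.inf hKrad, le_inf hIA le_sup_left, ?_⟩
      · refine (isInvertibleIdeal_mul_iff (B := A ⊔ (I ⊔ B N))).1 ?_ |>.1
        rw [hR.inf_mul_sup_of_isRadical hAinv.ne_bot hK0 hArad hKrad]
        exact isInvertibleIdeal_mul_iff.2 ⟨hAinv, hKinv⟩
      · rintro M hIM ⟨i, hi, hiM⟩
        rcases Finset.mem_insert.1 hi with rfl | hi
        · exact inf_le_right.trans (sup_le hIM hiM)
        · exact inf_le_left.trans (hA M hIM ⟨i, hi, hiM⟩)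
  obtain ⟨A, hAinv, hArad, hIA, hA⟩ := key s
  suffices I.radical = A by rwa [this]
  have hI' : I.radical ≠ ⊥ := ne_bot_of_le_ne_bot hI le_radical
  refine le_antisymm (hArad.radical_le_iff.2 hIA) ((hR.le_iff hAinv.ne_bot hI').2 fun M => ?_)
  by_cases hIM : I ≤ M.1
  · exact (hR.ord_le_one_of_isRadical M hI' (radical_isRadical I)).trans
      ((hR.one_le_ord_iff M hAinv.ne_bot).2 (hA M hIM (hs M hIM)))
  · rw [(hR.ord_eq_zero_iff M hI').2 fun h => hIM (le_radical.trans h)]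
    exact Nat.zero_le _

/-- If radicals of principal ideals are invertible, then every nonzero ideal is divisible by
its radical. -/
theorem exists_eq_radical_mul (hR : IsAlmostDedekind R)
    (h : ∀ I : Ideal R, I ≠ ⊥ → I.FG → I.radical.IsInvertibleIdeal) (hI : I ≠ ⊥) :
    ∃ I' : Ideal R, I' ≠ ⊥ ∧ I = I.radical * I' := by
  -- Each principal ideal in `I` is divided by its own radical; the sum of the quotients serves as
  -- `I'`.
  have hD : ∀ a : {a // a ∈ I ∧ a ≠ 0}, ∃ D : Ideal R,
      span {a.1} = (span {a.1}).radical * D := fun a =>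
    (h (span {a.1}) (by simpa using a.2.2) ⟨{a.1}, by simp⟩).exists_eq_mul_of_le le_radical
  choose D hD using hD
  have hrad : I.radical ≠ ⊥ := ne_bot_of_le_ne_bot hI le_radical
  have hle : I ≤ I.radical * ⨆ a, D a := by
    intro a ha
    rcases eq_or_ne a 0 with rfl | ha0
    · exact zero_mem _
    · rw [← span_singleton_le_iff_mem, hD ⟨a, ha, ha0⟩]
      exact mul_mono (radical_mono ((span_singleton_le_iff_mem _).2 ha)) (le_iSup D _)
  have hI' : (⨆ a, D a) ≠ ⊥ := ne_bot_of_le_ne_bot hI (hle.trans mul_le_right)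
  refine ⟨⨆ a, D a, hI', le_antisymm hle ?_⟩
  refine (hR.le_iff (mul_ne_zero hrad hI') hI).2 fun M => ?_
  rw [hR.ord_mul M hrad hI']
  by_cases hIM : I ≤ M.1
  · rw [hR.ord_eq_one_of_isRadical M hrad (radical_isRadical I)
      (M.2.1.isPrime.radical_le_iff.2 hIM)]
    suffices M.ord I - 1 ≤ M.ord (⨆ a, D a) by lia
    rw [hR.le_ord_iff M hI', Ideal.map_iSup]
    refine iSup_le fun a => ?_
    have ha : span {a.1} ≠ ⊥ := by simpa using a.2.2
    have hDa : D a ≠ ⊥ := fun h0 => ha (by rw [hD a, h0, mul_bot])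
    have hra : (span {a.1}).radical ≠ ⊥ := ne_bot_of_le_ne_bot ha le_radical
    rw [← hR.le_ord_iff M hDa]
    have h1 := congrArg M.ord (hD a)
    rw [hR.ord_mul M hra hDa] at h1
    have h2 := hR.ord_le_one_of_isRadical M hra (radical_isRadical _)
    have h3 := hR.ord_anti M ha ((span_singleton_le_iff_mem _).2 a.2.1)
    lia
  · rw [(hR.ord_eq_zero_iff M hI).2 hIM]
    exact Nat.zero_le _

/-- Dividing by the radical lowers the order by 1 exactly on the vanishing set of `I`, so level `k +
1` of `I` is that closed set intersected with level `k` of the quotient. -/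
theorem isClosed_setOf_le_ord (hR : IsAlmostDedekind R)
    (h : ∀ I : Ideal R, I ≠ ⊥ → I.FG → I.radical.IsInvertibleIdeal) (k : ℕ) (hI : I ≠ ⊥) :
    IsClosed {M : MaxInv R | k ≤ M.ord I} := by
  induction k generalizing I with
  | zero => simp
  | succ k ih =>
    obtain ⟨I', hI', hII'⟩ := hR.exists_eq_radical_mul h hI
    have hrad : I.radical ≠ ⊥ := ne_bot_of_le_ne_bot hI le_radical
    convert (MaxInv.isClosed_setOf_le I).inter (ih hI') using 1
    ext M
    simp only [Set.mem_ofPred_eq, Set.mem_inter_iff]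
    have h1 := congrArg M.ord hII'
    rw [hR.ord_mul M hrad hI'] at h1
    have h2 := hR.ord_le_one_of_isRadical M hrad (radical_isRadical _)
    have h3 := hR.one_le_ord_iff M hrad
    rw [M.2.1.isPrime.radical_le_iff, ← hR.one_le_ord_iff M hI] at h3
    rw [← hR.one_le_ord_iff M hI]
    lia

/-- Alexander's subbasis lemma reduces to covers by sets `V(B)` with `B` finitely generated. -/
theorem isCompact_setOf_le (hR : IsAlmostDedekind R) (hI : I ≠ ⊥) :
    IsCompact {M : MaxInv R | I ≤ M.1} := by
  refine isCompact_generateFrom rfl fun P hP hcov => ?_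
  choose B hB hPB using fun U : P => hP U.2
  obtain ⟨s, hs⟩ := hR.exists_finset_forall_exists_le hI hB fun M hM => by
    obtain ⟨U, hU, hMU⟩ := hcov hM
    refine ⟨⟨U, hU⟩, ?_⟩
    exact (hPB ⟨U, hU⟩ ▸ hMU : M ∈ MaxInv.V (B ⟨U, hU⟩))
  refine ⟨Subtype.val '' (s : Set P), by simp, (s.finite_toSet).image _, fun M hM => ?_⟩
  obtain ⟨U, hU, hMU⟩ := hs M hM
  refine ⟨U.1, ⟨U, hU, rfl⟩, ?_⟩
  rw [hPB U]
  exact hMU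

/-- The closed compact sets of nonzero maximal ideals are the vanishing sets of the nonzero
radical ideals. -/
theorem exists_isRadical_forall_le_iff (hR : IsAlmostDedekind R) {C : Set (MaxInv R)}
    (hC : IsClosed C) (hCc : IsCompact C) :
    ∃ I : Ideal R, I ≠ ⊥ ∧ I.IsRadical ∧ ∀ M : MaxInv R, I ≤ M.1 ↔ M ∈ C := by
  classical
  let I : Ideal R := ⨅ M ∈ C, M.1
  -- The intersection is nonzero because `C` is covered by finitely many `V(a M)`, and the product
  -- of these elements lies in every member of `C`.
  obtain ⟨a, ha0, ha⟩ : ∃ a : R, a ≠ 0 ∧ ∀ M ∈ C, a ∈ M.1 := by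
    choose a haM ha0 using fun M : MaxInv R => Submodule.exists_mem_ne_zero_of_ne_bot M.2.2
    obtain ⟨t, ht⟩ := hCc.elim_finite_subcover (fun M => MaxInv.V (span {a M}))
      (fun M => MaxInv.isOpen_V ⟨{a M}, by simp⟩) fun M _ =>
        Set.mem_iUnion.2 ⟨M, (span_singleton_le_iff_mem _).2 (haM M)⟩
    refine ⟨∏ M ∈ t, a M, Finset.prod_ne_zero_iff.2 fun M _ => ha0 M, fun N hN => ?_⟩
    obtain ⟨M, hM, hMN⟩ := Set.mem_iUnion₂.1 (ht hN)
    exact N.1.mem_of_dvd (Finset.dvd_prod_of_mem a hM) ((span_singleton_le_iff_mem _).1 hMN)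
  have haI : a ∈ I := by simpa [I, Submodule.mem_iInf] using ha
  refine ⟨I, fun h0 => ha0 (by rwa [h0] at haI), ?_, fun M => ⟨fun hIM => ?_, fun hM =>
    iInf₂_le M hM⟩⟩
  · rw [isRadical_iff_forall_mul_self_le]
    exact fun J hJ => le_iInf₂ fun M hM =>
      M.2.1.isPrime.isRadical.le_of_mul_self_le (hJ.trans (iInf₂_le M hM))
  · by_contra hM
    obtain ⟨B, hB, hMB, hBC⟩ := MaxInv.exists_fg_mem_V_subset hC.isOpen_compl hM
    obtain ⟨u, hu, hle⟩ := hR.exists_notMem_span_singleton_mul_pow_le M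
      (by simpa using ha0 : span {a} ≠ ⊥) hB hMB
    refine hu (hIM ?_)
    simp only [I, Submodule.mem_iInf]
    intro N hN
    rcases N.2.1.isPrime.mul_le.1 (hle.trans ((span_singleton_le_iff_mem _).2 (ha N hN))) with h | h
    · exact h (mem_span_singleton_self u)
    · exact absurd hN (hBC (N.2.1.isPrime.le_of_pow_le h : B ≤ N.1))

end IsAlmostDedekind

end InverseTopology

section Equivalences

open Ideal

/-! ### Semicontinuous functions and the lattice `U_b(X)`. -/

section UscFun

variable {X : Type*} [TopologicalSpace X]

theorem UscFun.exists_forall_le (f : UscFun X) : ∃ k, ∀ x, f.1 x ≤ k := by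
  obtain ⟨k, hk⟩ := (f.2.1.upperSemicontinuousOn (tsupport f.1)).bddAbove_of_isCompact f.2.2
  refine ⟨k, fun x => ?_⟩
  by_cases hx : x ∈ tsupport f.1
  · exact hk ⟨x, hx, rfl⟩
  · simp [image_eq_zero_of_notMem_tsupport hx]

/-- Every element of `U(X)` is a finite sum of characteristic functions. -/
theorem UscFun.exists_list_sum_eq (f : UscFun X) :
    ∃ l : List (UscFun X), (∀ g ∈ l, ∀ x, g.1 x ≤ 1) ∧ l.sum = f := by
  obtain ⟨k, hk⟩ := UscFun.exists_forall_le f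
  induction k generalizing f with
  | zero => exact ⟨[], by simp, Subtype.ext (funext fun x => (Nat.le_zero.1 (hk x)).symm)⟩
  | succ k ih =>
    -- Applied to truncated predecessor and to `min n 1`, which split `f` as `min f 1 + (f - 1)`.
    have hcomp (φ : ℕ → ℕ) (hφ : Monotone φ) (h0 : φ 0 = 0) : φ ∘ f.1 ∈ UscFun X := by
      refine ⟨upperSemicontinuous_iff_isClosed_preimage.2 fun y => ?_, f.2.2.comp_left h0⟩
      rcases (φ ⁻¹' Set.Ici y).eq_empty_or_nonempty with he | hne
      · rw [Set.preimage_comp, he]; exact isClosed_empty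
      · convert f.2.1.isClosed_preimage (sInf (φ ⁻¹' Set.Ici y)) using 1
        ext x
        refine ⟨fun hx => Nat.sInf_le hx, fun hx => ?_⟩
        exact (Nat.sInf_mem hne : y ≤ φ _).trans (hφ hx)
    obtain ⟨l, hl, hlf⟩ := ih ⟨_, hcomp (fun n => n - 1) (fun a b h => Nat.sub_le_sub_right h 1) rfl⟩
      fun x => by have := hk x; simp only [Function.comp_apply]; lia
    refine ⟨⟨_, hcomp (fun n => min n 1) (fun a b h => min_le_min_right 1 h) rfl⟩ :: l, ?_, ?_⟩
    · intro g hg x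
      rcases List.mem_cons.1 hg with rfl | hg
      · exact min_le_right _ _
      · exact hl g hg x
    · rw [List.sum_cons, hlf]
      refine Subtype.ext (funext fun x => ?_)
      change min (f.1 x) 1 + (f.1 x - 1) = f.1 x
      lia

/-- The element of `U_b(X)` given by a function in `U(X)`. -/
def UscLattice.of (f : UscFun X) : UscLattice X :=
  Multiplicative.ofAdd (OrderDual.toDual (f : WithTop (UscFun X)))

variable (X) in
/-- The least element `b` of `U_b(X)`. -/
def UscLattice.b : UscLattice X :=
  Multiplicative.ofAdd (OrderDual.toDual (⊤ : WithTop (UscFun X)))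

theorem UscLattice.eq_b_or_exists_of (z : UscLattice X) :
    z = UscLattice.b X ∨ ∃ f, z = UscLattice.of f := by
  obtain ⟨z, rfl⟩ := Multiplicative.ofAdd.surjective z
  obtain ⟨z, rfl⟩ := OrderDual.toDual.surjective z
  induction z using WithTop.recTopCoe with
  | top => exact .inl rfl
  | coe f => exact .inr ⟨f, rfl⟩

theorem UscLattice.b_le (z : UscLattice X) : UscLattice.b X ≤ z :=
  (le_top : (OrderDual.ofDual z.toAdd : WithTop (UscFun X)) ≤ ⊤)

theorem UscLattice.b_mul (z : UscLattice X) : UscLattice.b X * z = UscLattice.b X :=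
  congrArg (fun w => Multiplicative.ofAdd (OrderDual.toDual w))
    (WithTop.top_add (OrderDual.ofDual z.toAdd : WithTop (UscFun X)))

theorem UscLattice.mul_b (z : UscLattice X) : z * UscLattice.b X = UscLattice.b X := by
  rw [mul_comm, UscLattice.b_mul]

theorem UscLattice.of_add (f g : UscFun X) :
    UscLattice.of (f + g) = UscLattice.of f * UscLattice.of g := rfl

theorem UscLattice.of_le_of {f g : UscFun X} :
    UscLattice.of f ≤ UscLattice.of g ↔ ∀ x, g.1 x ≤ f.1 x :=
  (WithTop.coe_le_coe : (g : WithTop (UscFun X)) ≤ f ↔ g ≤ f)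

theorem UscLattice.not_of_le_b (f : UscFun X) : ¬ UscLattice.of f ≤ UscLattice.b X :=
  fun h => WithTop.coe_ne_top (top_le_iff.1
    (show (⊤ : WithTop (UscFun X)) ≤ (f : WithTop (UscFun X)) from h))

end UscFun

variable {R : Type*} [CommRing R] [IsDomain R]

/-- Functions bounded by 1 correspond to radical ideals, since `g ≤ 2 h` and `g ≤ 1` force `g ≤ h`
in `ℕ`; every function is a sum of these. -/
theorem isProdOfRadicals_of_orderMonoidIso {X : Type*} [TopologicalSpace X]
    (e : Ideal R ≃*o UscLattice X) (I : Ideal R) : I.IsProdOfRadicals := by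
  have hle (A B : Ideal R) : e A ≤ e B ↔ A ≤ B := map_le_map_iff e
  rcases UscLattice.eq_b_or_exists_of (e I) with h | ⟨f, hf⟩
  · refine ⟨[⊥], ?_, ?_⟩
    · simpa using (isPrime_bot : (⊥ : Ideal R).IsPrime).isRadical
    · have : I ≤ ⊥ := (hle _ _).1 (h ▸ UscLattice.b_le _)
      simpa using (le_bot_iff.1 this).symm
  · obtain ⟨l, hl, rfl⟩ := UscFun.exists_list_sum_eq f
    refine ⟨l.map fun g => e.symm (UscLattice.of g), ?_, e.toEquiv.injective (?_ : e _ = e I)⟩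
    · intro J hJ
      obtain ⟨g, hg, rfl⟩ := List.mem_map.1 hJ
      rw [isRadical_iff_forall_mul_self_le]
      intro A hA
      rw [← hle, map_mul, OrderMonoidIso.apply_symm_apply] at hA
      rw [← hle, OrderMonoidIso.apply_symm_apply]
      rcases UscLattice.eq_b_or_exists_of (e A) with h | ⟨h, hh⟩
      · exact h ▸ UscLattice.b_le _
      · rw [hh, ← UscLattice.of_add, UscLattice.of_le_of] at hA
        rw [hh, UscLattice.of_le_of]
        intro x
        have h1 : g.1 x ≤ h.1 x + h.1 x := hA x
        have h2 := hl g hg x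
        lia
    · rw [hf]
      clear hf hl
      induction l with
      | nil => exact map_one e
      | cons g l ih =>
        rw [List.map_cons, List.prod_cons, map_mul, ih, OrderMonoidIso.apply_symm_apply,
          List.sum_cons, UscLattice.of_add]

/-! ### The lattice isomorphism and radical chains. -/

namespace IsAlmostDedekind

variable {I J : Ideal R} (hR : IsAlmostDedekind R)
  (h : ∀ I : Ideal R, I ≠ ⊥ → I.FG → I.radical.IsInvertibleIdeal)

include hR h in
theorem ord_mem_uscFun (hI : I ≠ ⊥) : (fun M : MaxInv R => M.ord I) ∈ UscFun (MaxInv R) := by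
  refine ⟨upperSemicontinuous_iff_isClosed_preimage.2 fun k => hR.isClosed_setOf_le_ord h k hI,
    .intro (hR.isCompact_setOf_le hI) fun M hM => (hR.ord_eq_zero_iff M hI).2 hM⟩

include hR in
theorem exists_forall_ord_eq (f : UscFun (MaxInv R)) :
    ∃ I : Ideal R, I ≠ ⊥ ∧ ∀ M : MaxInv R, M.ord I = f.1 M := by
  obtain ⟨l, hl, rfl⟩ := UscFun.exists_list_sum_eq f
  induction l with
  | nil => exact ⟨⊤, top_ne_bot, hR.ord_top⟩
  | cons g l ih =>
    obtain ⟨I, hI, hIl⟩ := ih fun g hg => hl g (by simp [hg])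
    have hcl : IsClosed {M | 1 ≤ g.1 M} := g.2.1.isClosed_preimage 1
    have hcpt : IsCompact {M | 1 ≤ g.1 M} := by
      refine g.2.2.of_isClosed_subset hcl fun M (hM : 1 ≤ g.1 M) => subset_tsupport _ ?_
      exact Nat.one_le_iff_ne_zero.1 hM
    obtain ⟨J, hJ, hJrad, hJM⟩ := hR.exists_isRadical_forall_le_iff hcl hcpt
    refine ⟨J * I, mul_ne_zero hJ hI, fun M => ?_⟩
    rw [hR.ord_mul M hJ hI, hIl M, List.sum_cons]
    change _ = g.1 M + l.sum.1 M
    have h1 := hR.ord_le_one_of_isRadical M hJ hJrad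
    have h2 := hl g (by simp) M
    have h3 := hR.one_le_ord_iff M hJ
    rw [hJM M, Set.mem_ofPred_eq] at h3
    lia

include hR h in
theorem nonempty_orderMonoidIso : Nonempty (Ideal R ≃*o UscLattice (MaxInv R)) := by
  classical
  let φ : Ideal R → UscLattice (MaxInv R) := fun I =>
    if hI : I = ⊥ then UscLattice.b _ else UscLattice.of ⟨_, hR.ord_mem_uscFun h hI⟩
  have φ_bot : φ ⊥ = UscLattice.b _ := dif_pos rfl
  have φ_ne {I : Ideal R} (hI : I ≠ ⊥) : φ I = UscLattice.of ⟨_, hR.ord_mem_uscFun h hI⟩ :=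
    dif_neg hI
  have φ_le (I J : Ideal R) : φ I ≤ φ J ↔ I ≤ J := by
    rcases eq_or_ne I ⊥ with rfl | hI
    · simp [φ_bot, UscLattice.b_le]
    rcases eq_or_ne J ⊥ with rfl | hJ
    · simp [φ_bot, φ_ne hI, UscLattice.not_of_le_b, hI]
    · rw [φ_ne hI, φ_ne hJ, UscLattice.of_le_of, hR.le_iff hI hJ]
  have φ_mul (I J : Ideal R) : φ (I * J) = φ I * φ J := by
    rcases eq_or_ne I ⊥ with rfl | hI
    · rw [bot_mul, φ_bot, UscLattice.b_mul]
    rcases eq_or_ne J ⊥ with rfl | hJ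
    · rw [mul_bot, φ_bot, UscLattice.mul_b]
    · rw [φ_ne hI, φ_ne hJ, φ_ne (mul_ne_zero hI hJ), ← UscLattice.of_add]
      exact congrArg _ (Subtype.ext (funext fun M => hR.ord_mul M hI hJ))
  have φ_bij : Function.Bijective φ := by
    refine ⟨fun I J hIJ => le_antisymm ((φ_le I J).1 hIJ.le) ((φ_le J I).1 hIJ.ge), fun z => ?_⟩
    rcases UscLattice.eq_b_or_exists_of z with rfl | ⟨f, rfl⟩
    · exact ⟨⊥, φ_bot⟩
    · obtain ⟨I, hI, hIf⟩ := hR.exists_forall_ord_eq f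
      exact ⟨I, by rw [φ_ne hI]; exact congrArg _ (Subtype.ext (funext hIf))⟩
  exact ⟨{ Equiv.ofBijective φ φ_bij with
    map_mul' := φ_mul
    map_le_map_iff' := φ_le _ _ }⟩

omit [IsDomain R] in
-- The first entry is the smallest, so a power of it lies in the product, which in turn lies in it.
-- Uniqueness of chains follows by cancelling first entries.
theorem _root_.Ideal.IsProperRadicalChain.eq_radical {l : List (Ideal R)}
    (hl : I.IsProperRadicalChain (J :: l)) : J = I.radical := by
  obtain ⟨hJ, hpw, rfl⟩ := hl
  rw [List.pairwise_cons] at hpw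
  have hJr := (hJ J (by simp)).1
  refine le_antisymm ?_ (hJr.radical_le_iff.2 (by rw [List.prod_cons]; exact mul_le_left))
  have key : ∀ l : List (Ideal R), (∀ K ∈ l, J ≤ K) → J ^ l.length ≤ l.prod := by
    intro l hl
    induction l with
    | nil => simp
    | cons K l ih =>
      rw [List.length_cons, pow_succ', List.prod_cons]
      exact mul_mono (hl K (by simp)) (ih fun K hK => hl K (by simp [hK]))
  intro x hx
  exact ⟨_, key (J :: l) (by simpa using hpw.1) (pow_mem_pow hx _)⟩

include hR h in
-- Compact support bounds the orders of `I`, and splitting off the radical lowers the bound by 1.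
theorem exists_isProperRadicalChain (hI : I ≠ ⊥) : ∃ l, I.IsProperRadicalChain l := by
  obtain ⟨k, hk⟩ := UscFun.exists_forall_le ⟨_, hR.ord_mem_uscFun h hI⟩
  change ∀ M : MaxInv R, M.ord I ≤ k at hk
  induction k generalizing I with
  | zero =>
    have htop : I = ⊤ := (hR.eq_top_iff hI).2 fun M => Nat.le_zero.1 (hk M)
    exact ⟨[], by simp, by simp, by simp [htop]⟩
  | succ k ih =>
    rcases eq_or_ne I ⊤ with htop | htop
    · exact ⟨[], by simp, by simp, by simp [htop]⟩
    obtain ⟨I', hI', hII'⟩ := hR.exists_eq_radical_mul h hI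
    have hrad : I.radical ≠ ⊥ := ne_bot_of_le_ne_bot hI le_radical
    obtain ⟨l, hl, hpw, hprod⟩ := ih hI' fun M => by
      have h1 := congrArg M.ord hII'
      rw [hR.ord_mul M hrad hI'] at h1
      have h2 := hR.one_le_ord_iff M hrad
      rw [M.2.1.isPrime.radical_le_iff, ← hR.one_le_ord_iff M hI] at h2
      have h3 := hk M
      lia
    refine ⟨I.radical :: l, ?_, ?_, ?_⟩
    · intro J hJ
      rcases List.mem_cons.1 hJ with rfl | hJ
      · exact ⟨radical_isRadical I, by rwa [Ne, radical_eq_top]⟩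
      · exact hl J hJ
    · refine List.pairwise_cons.2 ⟨fun J hJ => (hl J hJ).1.radical_le_iff.2 ?_, hpw⟩
      rw [hII', ← hprod]
      exact mul_le_right.trans (le_of_dvd (List.dvd_prod hJ))
    · rw [List.prod_cons, hprod, ← hII']

include hR in
theorem isProperRadicalChain_unique (hI : I ≠ ⊥) {l l' : List (Ideal R)}
    (hl : I.IsProperRadicalChain l) (hl' : I.IsProperRadicalChain l') : l = l' := by
  have ne_top {I J : Ideal R} {l} (hl : I.IsProperRadicalChain (J :: l)) : I ≠ ⊤ := by
    refine ne_top_of_le_ne_top (hl.1 J (by simp)).2 ?_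
    rw [← hl.2.2, List.prod_cons]
    exact mul_le_left
  induction l generalizing I l' with
  | nil =>
    cases l' with
    | nil => rfl
    | cons J' l' => exact absurd (by rw [← hl.2.2]; exact one_eq_top) (ne_top hl')
  | cons J l ih =>
    cases l' with
    | nil => exact absurd (by rw [← hl'.2.2]; exact one_eq_top) (ne_top hl)
    | cons J' l' =>
      have hJJ' : J = J' := hl.eq_radical.trans hl'.eq_radical.symm
      subst hJJ'
      have hp : J * l.prod = I := by rw [← List.prod_cons]; exact hl.2.2
      have hp' : J * l'.prod = I := by rw [← List.prod_cons]; exact hl'.2.2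
      have hJ0 : J ≠ ⊥ := fun h0 => hI (by rw [← hp, h0, bot_mul])
      have hl0 : l.prod ≠ ⊥ := fun h0 => hI (by rw [← hp, h0, mul_bot])
      have hl0' : l'.prod ≠ ⊥ := fun h0 => hI (by rw [← hp', h0, mul_bot])
      have heq := hR.mul_left_cancel hJ0 hl0 hl0' (hp.trans hp'.symm)
      rw [ih hl0 ⟨fun K hK => hl.1 K (by simp [hK]), hl.2.1.of_cons, rfl⟩
        ⟨fun K hK => hl'.1 K (by simp [hK]), hl'.2.1.of_cons, heq.symm⟩]

end IsAlmostDedekind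

end Equivalences

theorem corollary7p7 (R : Type*) [CommRing R] [IsDomain R] :
    List.TFAE [
      -- (1)
      ∀ I : Ideal R, I ≠ ⊤ → I.IsProdOfRadicals,
      -- (2)
      ∀ I : Ideal R, I ≠ ⊥ → ∃! l : List (Ideal R), I.IsProperRadicalChain l,
      -- (3)
      ringKrullDim R ≤ 1 ∧ ∀ I : Ideal R, I.IsInvertibleIdeal → I.IsProdOfRadicals,
      -- (4)
      ∀ P : Ideal R, P.IsPrime → P ≠ ⊥ →
        P.IsMaximal ∧ ∃ J : Ideal R, J ≤ P ∧ J.IsInvertibleIdeal ∧ J.IsRadical,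
      -- (5)
      ∀ I : Ideal R, I ≠ ⊥ → I.FG → I.radical.IsInvertibleIdeal,
      -- (6) isomorphism of multiplicative lattices: bijective, multiplicative, and
      -- order-preserving in both directions
      Nonempty (Ideal R ≃*o UscLattice (MaxInv R)),
      -- (7)
      IsPruferDomain R ∧ ∀ I : Ideal R, I.FG → I.radical.FG] := by
  have hdim : ringKrullDim R ≤ 1 ↔ ∀ P : Ideal R, P ≠ ⊥ → P.IsPrime → P.IsMaximal := by
    rw [← Ring.krullDimLE_one_iff_of_noZeroDivisors, Ring.krullDimLE_iff, Nat.cast_one]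
  have almostDedekind (h4 : ∀ P : Ideal R, P.IsPrime → P ≠ ⊥ →
        P.IsMaximal ∧ ∃ J : Ideal R, J ≤ P ∧ J.IsInvertibleIdeal ∧ J.IsRadical) :
      IsAlmostDedekind R :=
    isAlmostDedekind_of_exists_isInvertibleIdeal_isRadical (fun P hP h0 => (h4 P hP h0).1)
      fun P hP h0 => (h4 P hP h0).2
  tfae_have 1 → 3 := fun h =>
    ⟨hdim.2 fun P h0 hP => hP.isMaximal_of_forall_isProdOfRadicals h h0, fun I _ => by
      rcases eq_or_ne I ⊤ with rfl | hI
      · exact ⟨[], by simp, Ideal.one_eq_top⟩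
      · exact h I hI⟩
  tfae_have 3 → 4 := fun ⟨h1, h⟩ P hP h0 => by
    refine ⟨hdim.1 h1 P h0 hP, ?_⟩
    obtain ⟨a, haP, ha0⟩ := Submodule.exists_mem_ne_zero_of_ne_bot h0
    have ha := Ideal.isInvertibleIdeal_span_singleton ha0
    obtain ⟨J, hJ, hJP, K, hK⟩ := (h _ ha).exists_isRadical_le hP
      ((Ideal.span_singleton_le_iff_mem _).2 haP)
    exact ⟨J, hJP, (Ideal.isInvertibleIdeal_mul_iff.1 (hK ▸ ha)).1, hJ⟩
  tfae_have 4 → 7 := fun h => by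
    have hR := almostDedekind h
    have hJ (M : MaxInv R) := (h M.1 M.2.1.isPrime M.2.2).2
    refine ⟨⟨inferInstance, fun I hI hfg => hR.isInvertibleIdeal_of_fg hJ hI hfg⟩,
      fun I hfg => ?_⟩
    rcases eq_or_ne I ⊥ with rfl | hI
    · rwa [(Ideal.isPrime_bot : (⊥ : Ideal R).IsPrime).radical]
    · exact (hR.isInvertibleIdeal_radical_of_fg hJ hI hfg).fg
  tfae_have 7 → 5 := fun ⟨h, hrad⟩ I hI hfg =>
    h.2 _ (ne_bot_of_le_ne_bot hI Ideal.le_radical) (hrad I hfg)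
  tfae_have 5 → 4 := fun h P hP h0 => by
    refine ⟨hP.isMaximal_of_forall_isInvertibleIdeal_radical h h0, ?_⟩
    obtain ⟨a, haP, ha0⟩ := Submodule.exists_mem_ne_zero_of_ne_bot h0
    exact ⟨(Ideal.span {a}).radical, hP.radical_le_iff.2 ((Ideal.span_singleton_le_iff_mem _).2 haP),
      h _ (by simpa using ha0) ⟨{a}, by simp⟩, Ideal.radical_isRadical _⟩
  tfae_have 5 → 2 := fun h I hI => by
    have hR := almostDedekind (tfae_5_to_4 h)
    obtain ⟨l, hl⟩ := hR.exists_isProperRadicalChain h hI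
    exact ⟨l, hl, fun l' hl' => hR.isProperRadicalChain_unique hI hl' hl⟩
  tfae_have 5 → 6 := fun h => (almostDedekind (tfae_5_to_4 h)).nonempty_orderMonoidIso h
  tfae_have 2 → 1 := fun h I _ => by
    rcases eq_or_ne I ⊥ with rfl | hI
    · exact ⟨[⊥], by simpa using (Ideal.isPrime_bot : (⊥ : Ideal R).IsPrime).isRadical, by simp⟩
    · obtain ⟨l, hl, -⟩ := h I hI
      exact ⟨l, fun J hJ => (hl.1 J hJ).1, hl.2.2⟩
  tfae_have 6 → 1 := fun ⟨e⟩ I _ => isProdOfRadicals_of_orderMonoidIso e I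
  tfae_finish
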